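/- Let $n\ge 4$. A permutation $\pi=\pi_1\pi_2\cdots\pi_n$ of $\{1,\dots,n\}$ \emph{contains} a permutation $\sigma=\sigma_1\cdots\sigma_m$ of $\{1,\dots,m\}$ if there are indices $i_1<i_2<\cdots<i_m$ such that $\pi_{i_1}\pi_{i_2}\cdots\pi_{i_m}$ is in the same relative order as $\sigma_1\sigma_2\cdots\sigma_m$, and otherwise it is \emph{$\sigma$-avoiding}. For $k\ge 0$ let $s_n^k(\sigma)$ denote the number of $\sigma$-avoiding permutations of $\{1,\dots,n\}$ with exactly $k$ fixed points, so that $s_n^0(\sigma)$ is the number of $\sigma$-avoiding derangements of length $n$. Then $$s_n^0(132)<s_n^0(123).$$ -/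

import Mathlib

namespace PermPattern

/-- The permutation `π` of `{0, …, n - 1}` contains the pattern `σ`: there are positions
`i 0 < i 1 < ⋯ < i (m - 1)` such that the word `π (i 0), …, π (i (m - 1))` is in the same
relative order as the word `σ 0, …, σ (m - 1)`. -/
def Contains {n m : ℕ} (π : Equiv.Perm (Fin n)) (σ : Equiv.Perm (Fin m)) : Prop :=
  ∃ i : Fin m → Fin n, StrictMono i ∧ ∀ a b : Fin m, π (i a) < π (i b) ↔ σ a < σ b

/-- `π` is `σ`-avoiding. -/
def Avoids {n m : ℕ} (π : Equiv.Perm (Fin n)) (σ : Equiv.Perm (Fin m)) : Prop :=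
  ¬ Contains π σ

/-- The number of fixed points of `π`. -/
def fp {n : ℕ} (π : Equiv.Perm (Fin n)) : ℕ :=
  (Finset.univ.filter fun i : Fin n => π i = i).card

/-- `s n k σ` is the number of `σ`-avoiding permutations of length `n` with exactly `k` fixed
points; for `k = 0` this counts the `σ`-avoiding derangements. -/
noncomputable def s (n k : ℕ) {m : ℕ} (σ : Equiv.Perm (Fin m)) : ℕ :=
  Set.ncard {π : Equiv.Perm (Fin n) | Avoids π σ ∧ fp π = k}

/-- The pattern `123`, with one-line notation `0, 1, 2` on `Fin 3`. -/
def p123 : Equiv.Perm (Fin 3) := 1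

/-- The pattern `132`, with one-line notation `0, 2, 1` on `Fin 3`. -/
def p132 : Equiv.Perm (Fin 3) := Equiv.swap 1 2

end PermPattern

/-!
Let `C n` be the Catalan numbers, which count both the `132`-avoiding and the `123`-avoiding
permutations of length `n`, and let `F n` be the number of `132`-avoiding derangements.

The points weakly to the south-west of the first fixed point of a `132`-avoiding permutation form a
block: a `132`-avoiding derangement, followed by the fixed point. What is left is an arbitrary
`132`-avoiding permutation, which has exactly one diagonal position where such a block fits. Hence
the generating functions satisfy `C = F + x * F * C`, and together with `C = 1 + x * C ^ 2` this
gives `C (n + 1) = 2 * F (n + 1) + F n`.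

A fixed point of a `123`-avoiding permutation is a left-to-right minimum or a right-to-left maximum.
Each of these occurs in at most `C (n - 1)` permutations: by symmetry the first suffices, the
Simion–Schmidt correspondence keeps the left-to-right minima and leads to `132`-avoiding
permutations, and there a fixed left-to-right minimum is a block of size one, which can be deleted.
So there are at least `C n - 2 * C (n - 1) + B n` derangements among the `123`-avoiding
permutations, where `B n` counts the permutations with fixed points of both kinds. As `n` grows,
`F n + 2 * C (n - 1)` is about `(4 / 9 + 1 / 2) * C n`; it is less than `C n` for `n ≥ 13`. For
`4 ≤ n ≤ 12`, inserting fixed points into skew sums gives a sufficient lower bound for `B n`.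
-/

open Finset Equiv

namespace PermPattern

/-! ### Permutations of `{0, …, n - 1}` as permutations of `ℕ` -/

/-- The permutations of `{0, …, n - 1}`, encoded as the permutations of `ℕ` that fix every
`x ≥ n`, so that permutations of different lengths have the same type. -/
def permsBelow (n : ℕ) : Finset (Perm ℕ) :=
  permsOfFinset (range n)

theorem mem_permsBelow {n : ℕ} {f : Perm ℕ} : f ∈ permsBelow n ↔ ∀ x, n ≤ x → f x = x := by
  simp only [permsBelow, mem_perms_of_finset_iff, mem_range, ne_eq]
  exact ⟨fun h x hx => by_contra fun hne => hx.not_gt (h hne),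
    fun h x hne => not_le.1 fun hx => hne (h x hx)⟩

theorem apply_lt_of_mem_permsBelow {n x : ℕ} {f : Perm ℕ} (hf : f ∈ permsBelow n) (hx : x < n) :
    f x < n := by
  by_contra! h
  have hfix : f x = x := f.injective (mem_permsBelow.1 hf _ h)
  omega

theorem permsBelow_mono {m n : ℕ} (h : m ≤ n) : permsBelow m ⊆ permsBelow n := fun _ hf =>
  mem_permsBelow.2 fun x hx => mem_permsBelow.1 hf x (h.trans hx)

theorem one_mem_permsBelow (n : ℕ) : 1 ∈ permsBelow n :=
  mem_permsBelow.2 fun _ _ => rfl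

theorem symm_mem_permsBelow {n : ℕ} {f : Perm ℕ} (hf : f ∈ permsBelow n) :
    f.symm ∈ permsBelow n :=
  mem_permsBelow.2 fun x hx => f.symm_apply_eq.2 (mem_permsBelow.1 hf x hx).symm

theorem mul_mem_permsBelow {n : ℕ} {f g : Perm ℕ} (hf : f ∈ permsBelow n)
    (hg : g ∈ permsBelow n) : f * g ∈ permsBelow n :=
  mem_permsBelow.2 fun x hx => by
    rw [Perm.mul_apply, mem_permsBelow.1 hg x hx, mem_permsBelow.1 hf x hx]

theorem swap_mem_permsBelow {n j k : ℕ} (hj : j < n) (hk : k < n) : swap j k ∈ permsBelow n :=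
  mem_permsBelow.2 fun _ hx => swap_apply_of_ne_of_ne (hj.trans_le hx).ne' (hk.trans_le hx).ne'

/-- The permutation of `ℕ` that acts as `π` on `{0, …, n - 1}` and fixes everything else. -/
noncomputable def extendFin {n : ℕ} (π : Perm (Fin n)) : Perm ℕ :=
  π.viaEmbedding Fin.valEmbedding

theorem extendFin_apply {n : ℕ} (π : Perm (Fin n)) (x : Fin n) : extendFin π x = π x :=
  Perm.viaEmbedding_apply π Fin.valEmbedding x

theorem extendFin_injective {n : ℕ} : Function.Injective (extendFin (n := n)) :=
  Perm.viaEmbeddingHom_injective Fin.valEmbedding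

theorem map_extendFin (n : ℕ) :
    univ.map ⟨extendFin (n := n), extendFin_injective⟩ = permsBelow n := by
  apply eq_of_subset_of_card_le
  · simp only [subset_iff, mem_map, mem_univ, true_and]
    rintro _ ⟨π, rfl⟩
    refine mem_permsBelow.2 fun x hx => Perm.viaEmbedding_apply_of_notMem π _ x ?_
    rintro ⟨y, rfl⟩
    exact y.isLt.not_ge hx
  · rw [card_map, permsBelow, card_perms_of_finset, card_range, card_univ, Fintype.card_perm,
      Fintype.card_fin]

theorem s_zero_eq_card {n m : ℕ} {σ : Perm (Fin m)} {A : Finset (Perm ℕ)}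
    (hA : A ⊆ permsBelow n) (h : ∀ π : Perm (Fin n), Avoids π σ ↔ extendFin π ∈ A) :
    s n 0 σ = #{f ∈ A | ∀ x < n, f x ≠ x} := by
  have hfp (π : Perm (Fin n)) : fp π = 0 ↔ ∀ x < n, extendFin π x ≠ x := by
    simp only [fp, card_eq_zero, filter_eq_empty_iff, mem_univ, true_imp_iff, Fin.ext_iff,
      ← extendFin_apply, Fin.forall_iff, ne_eq]
  have himage : extendFin '' {π : Perm (Fin n) | Avoids π σ ∧ fp π = 0} =
      ({f ∈ A | ∀ x < n, f x ≠ x} : Finset (Perm ℕ)) := by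
    ext f
    simp only [Set.mem_image, Set.mem_ofPred_eq, coe_filter, h, hfp]
    constructor
    · rintro ⟨π, hπ, rfl⟩
      exact hπ
    · intro hf
      obtain ⟨π, -, rfl⟩ := mem_map.1 ((map_extendFin n).ge (hA hf.1))
      exact ⟨π, hf, rfl⟩
  rw [s, ← Set.ncard_image_of_injective _ extendFin_injective, himage, Set.ncard_coe_finset]

theorem contains_iff_strictMono {n m : ℕ} {π : Perm (Fin n)} {σ : Perm (Fin m)} :
    Contains π σ ↔ ∃ i : Fin m → Fin n, StrictMono i ∧ StrictMono (π ∘ i ∘ σ.symm) := by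
  refine exists_congr fun i => and_congr_right fun _ => ⟨fun h a b hab => ?_, fun h a b => ?_⟩
  · exact (h _ _).2 (by simpa only [apply_symm_apply] using hab)
  · simpa only [Function.comp_apply, symm_apply_apply] using h.lt_iff_lt (a := σ a) (b := σ b)

theorem strictMono_fin_three_iff {α : Type*} [Preorder α] {g : Fin 3 → α} :
    StrictMono g ↔ g 0 < g 1 ∧ g 1 < g 2 := by
  rw [Fin.strictMono_iff_lt_succ, Fin.forall_fin_two]
  rfl

/-- `f` avoids the pattern `132`: no positions `a < b < c` satisfy `f a < f c < f b`. For
`f ∈ permsBelow n` the positions need not be restricted to `{0, …, n - 1}`, as the points `(x, x)`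
with `n ≤ x` lie to the north-east of all others. -/
def Avoids132 (f : Perm ℕ) : Prop :=
  ∀ ⦃a b c⦄, a < b → b < c → f a < f c → f b < f c

/-- The word `f 0, …, f (n - 1)` avoids the pattern `123`. -/
def Avoids123 (n : ℕ) (f : Perm ℕ) : Prop :=
  ∀ ⦃a b c⦄, a < b → b < c → c < n → f a < f b → f c < f b

open Classical in
/-- The `132`-avoiding permutations of `{0, …, n - 1}`. -/
noncomputable def av132 (n : ℕ) : Finset (Perm ℕ) :=
  {f ∈ permsBelow n | Avoids132 f}

open Classical in
/-- The `123`-avoiding permutations of `{0, …, n - 1}`. -/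
noncomputable def av123 (n : ℕ) : Finset (Perm ℕ) :=
  {f ∈ permsBelow n | Avoids123 n f}

/-- The `132`-avoiding derangements of `{0, …, n - 1}`. -/
noncomputable def der132 (n : ℕ) : Finset (Perm ℕ) :=
  {f ∈ av132 n | ∀ x < n, f x ≠ x}

/-- The `123`-avoiding derangements of `{0, …, n - 1}`. -/
noncomputable def der123 (n : ℕ) : Finset (Perm ℕ) :=
  {f ∈ av123 n | ∀ x < n, f x ≠ x}

theorem mem_av132 {n : ℕ} {f : Perm ℕ} : f ∈ av132 n ↔ f ∈ permsBelow n ∧ Avoids132 f := by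
  simp only [av132, mem_filter]

theorem mem_av123 {n : ℕ} {f : Perm ℕ} : f ∈ av123 n ↔ f ∈ permsBelow n ∧ Avoids123 n f := by
  simp only [av123, mem_filter]

theorem mem_der132 {n : ℕ} {f : Perm ℕ} : f ∈ der132 n ↔ f ∈ av132 n ∧ ∀ x < n, f x ≠ x :=
  mem_filter

theorem Avoids132.of_lt {n : ℕ} {f : Perm ℕ} (hf : f ∈ permsBelow n)
    (h : ∀ ⦃a b c⦄, a < b → b < c → c < n → f a < f c → f b < f c) : Avoids132 f := by
  intro a b c hab hbc hac
  obtain hc | hc := lt_or_ge c n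
  · exact h hab hbc hc hac
  · rw [mem_permsBelow.1 hf c hc]
    obtain hb | hb := lt_or_ge b n
    · exact (apply_lt_of_mem_permsBelow hf hb).trans_le hc
    · rwa [mem_permsBelow.1 hf b hb]

theorem Avoids132.symm {f : Perm ℕ} (hf : Avoids132 f) : Avoids132 f.symm := by
  intro a b c hab hbc hac
  by_contra! hcb
  have hne : f.symm c ≠ f.symm b := f.symm.injective.ne hbc.ne'
  have := hf hac (lt_of_le_of_ne hcb hne)
  simp only [apply_symm_apply] at this
  exact (this hab).asymm hbc

theorem avoids_p132_iff {n : ℕ} (π : Perm (Fin n)) : Avoids π p132 ↔ extendFin π ∈ av132 n := by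
  have hmem : extendFin π ∈ permsBelow n :=
    (map_extendFin n).le (mem_map_of_mem _ (mem_univ π))
  rw [Avoids, contains_iff_strictMono, mem_av132, and_iff_right hmem]
  constructor
  · intro h
    refine Avoids132.of_lt hmem fun a b c hab hbc hc hac => ?_
    by_contra! hcb
    lift a to Fin n using by omega
    lift b to Fin n using by omega
    lift c to Fin n using hc
    simp only [extendFin_apply] at hac hcb
    refine h ⟨![a, b, c], strictMono_fin_three_iff.2 ⟨hab, hbc⟩,
      strictMono_fin_three_iff.2 ⟨hac, lt_of_le_of_ne hcb ?_⟩⟩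
    exact fun heq => hbc.ne' (congrArg Fin.val (π.injective heq))
  · rintro h ⟨i, hi, hπ⟩
    obtain ⟨h01, h12⟩ := strictMono_fin_three_iff.1 hi
    obtain ⟨h02, h21⟩ := strictMono_fin_three_iff.1 hπ
    have := h (a := i 0) (b := i 1) (c := i 2) h01 h12
    simp only [extendFin_apply] at this
    exact (this h02).asymm h21

theorem avoids_p123_iff {n : ℕ} (π : Perm (Fin n)) : Avoids π p123 ↔ extendFin π ∈ av123 n := by
  have hmem : extendFin π ∈ permsBelow n :=
    (map_extendFin n).le (mem_map_of_mem _ (mem_univ π))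
  rw [Avoids, contains_iff_strictMono, mem_av123, and_iff_right hmem]
  constructor
  · intro h a b c hab hbc hc hlt
    by_contra! hle
    lift a to Fin n using by omega
    lift b to Fin n using by omega
    lift c to Fin n using hc
    simp only [extendFin_apply] at hlt hle
    refine h ⟨![a, b, c], strictMono_fin_three_iff.2 ⟨hab, hbc⟩,
      strictMono_fin_three_iff.2 ⟨hlt, lt_of_le_of_ne hle ?_⟩⟩
    exact fun heq => hbc.ne (congrArg Fin.val (π.injective heq))
  · rintro h ⟨i, hi, hπ⟩
    obtain ⟨h01, h12⟩ := strictMono_fin_three_iff.1 hi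
    obtain ⟨hπ01, hπ12⟩ := strictMono_fin_three_iff.1 hπ
    have := h (a := i 0) (b := i 1) (c := i 2) h01 h12 (i 2).isLt
    simp only [extendFin_apply] at this
    exact (this hπ01).asymm hπ12

theorem s_zero_p132 (n : ℕ) : s n 0 p132 = #(der132 n) :=
  s_zero_eq_card (fun _ hf => (mem_av132.1 hf).1) avoids_p132_iff

theorem s_zero_p123 (n : ℕ) : s n 0 p123 = #(der123 n) :=
  s_zero_eq_card (fun _ hf => (mem_av123.1 hf).1) avoids_p123_iff

/-! ### Inflating a point to a block -/

/-- The increasing enumeration of `ℕ` with the interval `{p, …, p + c - 1}` left out. -/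
def gap (p c x : ℕ) : ℕ :=
  if x < p then x else x + c

/-- The left inverse of `gap p c`. -/
def ungap (p c x : ℕ) : ℕ :=
  if x < p then x else x - c

theorem gap_of_lt {p c x : ℕ} (h : x < p) : gap p c x = x :=
  if_pos h

theorem gap_of_le {p c x : ℕ} (h : p ≤ x) : gap p c x = x + c :=
  if_neg h.not_gt

theorem strictMono_gap (p c : ℕ) : StrictMono (gap p c) := by
  intro x y h
  unfold gap
  split_ifs <;> omega

theorem gap_lt_or_le_gap (p c x : ℕ) : x < p ∧ gap p c x < p ∨ p ≤ x ∧ p + c ≤ gap p c x := by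
  unfold gap
  split_ifs <;> omega

theorem gap_lt_iff {p c x : ℕ} : gap p c x < p ↔ x < p := by
  unfold gap
  split_ifs <;> omega

theorem gap_lt_add_iff {p c m x : ℕ} (hp : p ≤ m) : gap p c x < m + c ↔ x < m := by
  unfold gap
  split_ifs <;> omega

theorem ungap_gap (p c x : ℕ) : ungap p c (gap p c x) = x := by
  unfold gap ungap
  split_ifs <;> omega

theorem gap_ungap {p c x : ℕ} (h : ¬(p ≤ x ∧ x < p + c)) : gap p c (ungap p c x) = x := by
  unfold gap ungap
  split_ifs <;> omega

theorem not_mem_block_gap (p c x : ℕ) : ¬(p ≤ gap p c x ∧ gap p c x < p + c) := by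
  have := gap_lt_or_le_gap p c x
  omega

theorem exists_gap_eq_or_exists_add_eq (p c x : ℕ) :
    (∃ y, gap p c y = x) ∨ ∃ y < c, p + y = x := by
  by_cases h : p ≤ x ∧ x < p + c
  · exact .inr ⟨x - p, by omega, by omega⟩
  · exact .inl ⟨ungap p c x, gap_ungap h⟩

/-- The underlying function of `insertId`. -/
def insertIdFun (p v c : ℕ) (g : ℕ → ℕ) (x : ℕ) : ℕ :=
  if p ≤ x ∧ x < p + c then v + (x - p) else gap v c (g (ungap p c x))

theorem leftInverse_insertIdFun {g h : ℕ → ℕ} (hgh : Function.LeftInverse h g) (p v c : ℕ) :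
    Function.LeftInverse (insertIdFun v p c h) (insertIdFun p v c g) := by
  intro x
  unfold insertIdFun
  by_cases hx : p ≤ x ∧ x < p + c
  · rw [if_pos hx, if_pos (by omega)]
    omega
  · rw [if_neg hx, if_neg (not_mem_block_gap _ _ _), ungap_gap, hgh, gap_ungap hx]

/-- The graph of `insertId p v c τ` arises from that of `τ` by inserting an increasing run of `c`
points that starts at `(p, v)`. -/
def insertId (p v c : ℕ) (τ : Perm ℕ) : Perm ℕ where
  toFun := insertIdFun p v c τ
  invFun := insertIdFun v p c τ.symm
  left_inv := leftInverse_insertIdFun τ.left_inv p v c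
  right_inv := leftInverse_insertIdFun τ.right_inv v p c

/-- The graph of `inflate p v c β τ` arises from that of `τ` by inserting a copy of the graph of
`β ∈ permsBelow c` with lower left corner `(p, v)`. -/
noncomputable def inflate (p v c : ℕ) (β τ : Perm ℕ) : Perm ℕ :=
  insertId p v c τ * β.viaEmbedding (addLeftEmbedding p)

section Inflate

variable {p v c : ℕ} {β τ : Perm ℕ}

theorem inflate_gap (hβ : β ∈ permsBelow c) (x : ℕ) :
    inflate p v c β τ (gap p c x) = gap v c (τ x) := by
  have hfix : β.viaEmbedding (addLeftEmbedding p) (gap p c x) = gap p c x := by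
    obtain ⟨-, hx⟩ | ⟨-, hx⟩ := gap_lt_or_le_gap p c x
    · refine Perm.viaEmbedding_apply_of_notMem _ _ _ ?_
      rintro ⟨y, hy : p + y = _⟩
      omega
    · obtain ⟨y, hy⟩ := Nat.exists_eq_add_of_le (le_of_add_le_left hx)
      rw [hy]
      refine (Perm.viaEmbedding_apply β (addLeftEmbedding p) y).trans ?_
      rw [mem_permsBelow.1 hβ y (by omega), addLeftEmbedding_apply]
  rw [inflate, Perm.mul_apply, hfix]
  exact (if_neg (not_mem_block_gap _ _ _)).trans (by rw [ungap_gap])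

theorem inflate_add (hβ : β ∈ permsBelow c) {y : ℕ} (hy : y < c) :
    inflate p v c β τ (p + y) = v + β y := by
  have hβy := apply_lt_of_mem_permsBelow hβ hy
  have hact : β.viaEmbedding (addLeftEmbedding p) (p + y) = p + β y :=
    Perm.viaEmbedding_apply β (addLeftEmbedding p) y
  rw [inflate, Perm.mul_apply, hact]
  exact (if_pos (by omega)).trans (by omega)

theorem inflate_injective {β' τ' : Perm ℕ} (hβ : β ∈ permsBelow c) (hβ' : β' ∈ permsBelow c)
    (h : inflate p v c β τ = inflate p v c β' τ') : β = β' ∧ τ = τ' := by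
  constructor
  · ext y
    obtain hy | hy := lt_or_ge y c
    · have := congrArg (· (p + y)) h
      simpa only [inflate_add hβ hy, inflate_add hβ' hy, add_right_inj] using this
    · rw [mem_permsBelow.1 hβ y hy, mem_permsBelow.1 hβ' y hy]
  · ext x
    have := congrArg (· (gap p c x)) h
    simp only [inflate_gap hβ, inflate_gap hβ'] at this
    exact (strictMono_gap v c).injective this

theorem inflate_mem_permsBelow_iff {m : ℕ} (hβ : β ∈ permsBelow c) (hp : p ≤ m) (hv : v ≤ m) :
    inflate p v c β τ ∈ permsBelow (m + c) ↔ τ ∈ permsBelow m := by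
  simp only [mem_permsBelow]
  constructor
  · intro h x hx
    have := h _ (Nat.add_le_add_right hx c)
    rw [← gap_of_le (hp.trans hx), inflate_gap hβ, gap_of_le (hp.trans hx),
      ← gap_of_le (hv.trans hx)] at this
    exact (strictMono_gap v c).injective this
  · intro h x hx
    obtain ⟨y, hy, rfl⟩ := Nat.exists_eq_add_of_le' (le_of_add_le_right hx)
    have hy : m ≤ y := Nat.le_of_add_le_add_right hx
    rw [← gap_of_le (hp.trans hy), inflate_gap hβ, h y hy, gap_of_le (hp.trans hy),
      gap_of_le (hv.trans hy)]

theorem exists_mem_permsBelow_add_eq {f : Perm ℕ}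
    (h : ∀ x, p ≤ x ∧ x < p + c ↔ v ≤ f x ∧ f x < v + c) :
    ∃ β ∈ permsBelow c, ∀ y < c, v + β y = f (p + y) := by
  let blockFun (p v : ℕ) (g : ℕ → ℕ) (y : ℕ) : ℕ := if y < c then g (p + y) - v else y
  have leftInverse {p v : ℕ} {g : Perm ℕ} (hg : ∀ x, p ≤ x → x < p + c → v ≤ g x ∧ g x < v + c) :
      Function.LeftInverse (blockFun v p g.symm) (blockFun p v g) := by
    intro y
    obtain hy | hy := lt_or_ge y c
    · have := hg (p + y) (by omega) (by omega)
      simp only [blockFun, if_pos hy]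
      rw [if_pos (by omega), Nat.add_sub_cancel' this.1, g.symm_apply_apply,
        Nat.add_sub_cancel_left]
    · simp only [blockFun, if_neg hy.not_gt]
  have hsymm (x) (hv : v ≤ x) (hx : x < v + c) : p ≤ f.symm x ∧ f.symm x < p + c :=
    (h _).2 (by rw [f.apply_symm_apply]; exact ⟨hv, hx⟩)
  let β : Perm ℕ :=
    { toFun := blockFun p v f
      invFun := blockFun v p f.symm
      left_inv := leftInverse fun x hp hx => (h x).1 ⟨hp, hx⟩
      right_inv := leftInverse hsymm }
  refine ⟨β, mem_permsBelow.2 fun y hy => if_neg hy.not_gt, fun y hy => ?_⟩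
  have hβy : β y = f (p + y) - v := if_pos hy
  rw [hβy, Nat.add_sub_cancel' ((h (p + y)).1 (by omega)).1]

theorem exists_gap_apply_eq {f : Perm ℕ}
    (h : ∀ x, p ≤ x ∧ x < p + c ↔ v ≤ f x ∧ f x < v + c) :
    ∃ τ : Perm ℕ, ∀ x, gap v c (τ x) = f (gap p c x) := by
  have hf (x) : gap v c (ungap v c (f (gap p c x))) = f (gap p c x) :=
    gap_ungap fun hx => not_mem_block_gap p c x ((h _).2 hx)
  have hf' (x) : gap p c (ungap p c (f.symm (gap v c x))) = f.symm (gap v c x) :=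
    gap_ungap fun hx => not_mem_block_gap v c x (by simpa only [h, f.apply_symm_apply] using hx)
  let τ : Perm ℕ :=
    { toFun x := ungap v c (f (gap p c x))
      invFun x := ungap p c (f.symm (gap v c x))
      left_inv x := by simp only [hf, f.symm_apply_apply, ungap_gap]
      right_inv x := by simp only [hf', f.apply_symm_apply, ungap_gap] }
  exact ⟨τ, hf⟩

theorem exists_inflate_eq {f : Perm ℕ}
    (h : ∀ x, p ≤ x ∧ x < p + c ↔ v ≤ f x ∧ f x < v + c) :
    ∃ β ∈ permsBelow c, ∃ τ, inflate p v c β τ = f := by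
  obtain ⟨β, hβ, hfβ⟩ := exists_mem_permsBelow_add_eq h
  obtain ⟨τ, hfτ⟩ := exists_gap_apply_eq h
  refine ⟨β, hβ, τ, Equiv.ext fun x => ?_⟩
  obtain ⟨y, rfl⟩ | ⟨y, hy, rfl⟩ := exists_gap_eq_or_exists_add_eq p c x
  · rw [inflate_gap hβ, hfτ]
  · rw [inflate_add hβ hy, hfβ y hy]

end Inflate

/-! ### Corners of `132`-avoiding permutations -/

/-- No point of the graph of `τ` lies to the south-west of the grid point `(p, v)`, and the points
to its north-east form an increasing sequence. These are the places where a `132`-avoiding block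
can be inserted into a `132`-avoiding permutation, see `IsCorner.avoids132_inflate`. -/
structure IsCorner (p v : ℕ) (τ : Perm ℕ) : Prop where
  le_apply : ∀ ⦃x⦄, x < p → v ≤ τ x
  strictMonoOn : StrictMonoOn τ {x | p ≤ x ∧ v ≤ τ x}

section Corner

variable {p v c : ℕ} {β τ : Perm ℕ}

theorem IsCorner.add_le_inflate_of_lt (hτ : IsCorner p v τ) (hβ : β ∈ permsBelow c) {x : ℕ}
    (hx : x < p) : v + c ≤ inflate p v c β τ x := by
  have hle := hτ.le_apply hx
  rw [← gap_of_lt (c := c) hx, inflate_gap hβ, gap_of_le hle]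
  omega

theorem IsCorner.add_lt_of_gap_lt_add (hτ : IsCorner p v τ) (hβ : β ∈ permsBelow c) {x y : ℕ}
    (hy : y < c) (hxy : gap p c x < p + y) : v + β y < gap v c (τ x) := by
  have hβy := apply_lt_of_mem_permsBelow hβ hy
  have hx : x < p := by
    have := gap_lt_or_le_gap p c x
    omega
  rw [gap_of_le (hτ.le_apply hx)]
  have := hτ.le_apply hx
  omega

theorem IsCorner.avoids132_inflate (hcorner : IsCorner p v τ) (hτ : Avoids132 τ)
    (hβ : β ∈ permsBelow c) (hβ' : Avoids132 β) : Avoids132 (inflate p v c β τ) := by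
  intro x y z hxy hyz hxz
  have hp := gap_lt_or_le_gap p c
  have hv := gap_lt_or_le_gap v c
  obtain ⟨x, rfl⟩ | ⟨x, hx, rfl⟩ := exists_gap_eq_or_exists_add_eq p c x
  · have hsw {w} (hw : w < c) (hxw : gap p c x < p + w) := hcorner.add_lt_of_gap_lt_add hβ hw hxw
    obtain ⟨z, rfl⟩ | ⟨z, hz, rfl⟩ := exists_gap_eq_or_exists_add_eq p c z
    · rw [inflate_gap hβ, inflate_gap hβ] at hxz
      obtain ⟨y, rfl⟩ | ⟨y, hy, rfl⟩ := exists_gap_eq_or_exists_add_eq p c y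
      · simp only [inflate_gap hβ, (strictMono_gap _ c).lt_iff_lt] at hxy hyz hxz ⊢
        exact hτ hxy hyz hxz
      · rw [inflate_gap hβ, inflate_add hβ hy]
        exact (hsw hy hxy).trans hxz
    · rw [inflate_gap hβ, inflate_add hβ hz] at hxz
      exact absurd hxz (hsw hz (hxy.trans hyz)).asymm
  · obtain ⟨z, rfl⟩ | ⟨z, hz, rfl⟩ := exists_gap_eq_or_exists_add_eq p c z
    · rw [inflate_add hβ hx, inflate_gap hβ] at hxz
      obtain ⟨y, rfl⟩ | ⟨y, hy, rfl⟩ := exists_gap_eq_or_exists_add_eq p c y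
      · simp only [inflate_gap hβ, (strictMono_gap _ c).lt_iff_lt] at hyz ⊢
        have hpy : p ≤ y := by have := hp y; omega
        have hvz : v ≤ τ z := by have := hv (τ z); omega
        obtain hvy | hvy := lt_or_ge (τ y) v
        · exact hvy.trans_le hvz
        · exact hcorner.strictMonoOn ⟨hpy, hvy⟩ ⟨hpy.trans hyz.le, hvz⟩ hyz
      · rw [inflate_gap hβ, inflate_add hβ hy]
        have hβy := apply_lt_of_mem_permsBelow hβ hy
        have := hv (τ z)
        omega
    · obtain ⟨y, rfl⟩ := Nat.exists_eq_add_of_le ((Nat.le_add_right p x).trans hxy.le)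
      simp only [inflate_add hβ, hx, hz, (by omega : y < c), add_lt_add_iff_left] at hxy hyz hxz ⊢
      exact hβ' hxy hyz hxz

theorem Avoids132.of_inflate_outer (hβ : β ∈ permsBelow c)
    (h : Avoids132 (inflate p v c β τ)) : Avoids132 τ := by
  intro x y z hxy hyz hxz
  have hmono := strictMono_gap p c
  have := h (hmono hxy) (hmono hyz)
  simp only [inflate_gap hβ, (strictMono_gap v c).lt_iff_lt] at this
  exact this hxz

theorem Avoids132.of_inflate_inner (hβ : β ∈ permsBelow c)
    (h : Avoids132 (inflate p v c β τ)) : Avoids132 β := by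
  refine Avoids132.of_lt hβ fun x y z hxy hyz hz hxz => ?_
  have hy := hyz.trans hz
  have := h (Nat.add_lt_add_left hxy p) (Nat.add_lt_add_left hyz p)
  simp only [inflate_add hβ, hxy.trans hy, hy, hz, add_lt_add_iff_left] at this
  exact this hxz

theorem isCorner_of_avoids132_inflate (hβ : β ∈ permsBelow c) (hc : 0 < c)
    (h : Avoids132 (inflate p v c β τ)) (hle : ∀ x < p, v ≤ τ x) : IsCorner p v τ := by
  refine ⟨hle, ?_⟩
  rintro x ⟨hpx, -⟩ y ⟨-, hvy⟩ hxy
  have hβ0 := apply_lt_of_mem_permsBelow hβ hc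
  have := @h (p + 0) (gap p c x) (gap p c y) (by rw [gap_of_le hpx]; omega)
    (strictMono_gap p c hxy)
  rw [inflate_gap hβ, inflate_gap hβ, inflate_add hβ hc, (strictMono_gap v c).lt_iff_lt,
    gap_of_le hvy] at this
  exact this (by omega)

/-- The diagonal grid point `(corner τ, corner τ)` is the only candidate for a corner of `τ` on the
diagonal, see `isCorner_corner` and `IsCorner.corner_eq`. -/
noncomputable def corner (τ : Perm ℕ) : ℕ :=
  sInf {k | ∃ x ≤ k, τ x ≤ k}

theorem isCorner_corner (hτ : Avoids132 τ) : IsCorner (corner τ) (corner τ) τ := by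
  set k := corner τ
  have hle (x) (hx : x < k) : k ≤ τ x := by
    by_contra! hlt
    have := Nat.sInf_le (s := {k | ∃ x ≤ k, τ x ≤ k}) ⟨x, le_max_left x (τ x), le_max_right x (τ x)⟩
    exact (max_lt hx hlt).not_ge this
  obtain ⟨z, hzk, hτz⟩ : ∃ z ≤ k, τ z ≤ k :=
    Nat.sInf_mem (s := {k | ∃ x ≤ k, τ x ≤ k}) ⟨τ 0, 0, Nat.zero_le _, le_rfl⟩
  refine ⟨hle, ?_⟩
  rintro x ⟨hkx, hkτx⟩ y ⟨-, hkτy⟩ hxy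
  have hzy : τ z ≠ τ y := τ.injective.ne (by omega)
  obtain rfl | hzx := eq_or_ne z x
  · omega
  · exact hτ (by omega : z < x) hxy (by omega)

theorem corner_le {m : ℕ} (hτ : τ ∈ permsBelow m) : corner τ ≤ m :=
  Nat.sInf_le ⟨m, le_rfl, (mem_permsBelow.1 hτ m le_rfl).le⟩

theorem IsCorner.diag_unique {k l : ℕ} (hk : IsCorner k k τ) (hl : IsCorner l l τ) : k = l := by
  suffices h : ∀ {k l}, IsCorner k k τ → IsCorner l l τ → l ≤ k from le_antisymm (h hl hk) (h hk hl)
  intro k l hk hl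
  by_contra! hkl
  have hτk : l ≤ τ k := hl.le_apply hkl
  have hl' : l ≤ τ.symm k := by
    by_contra! hlt
    have := hl.le_apply hlt
    rw [τ.apply_symm_apply] at this
    omega
  have := hk.strictMonoOn (a := k) (b := τ.symm k) ⟨le_rfl, by omega⟩
    ⟨by omega, (τ.apply_symm_apply k).ge⟩ (by omega)
  rw [τ.apply_symm_apply] at this
  omega

end Corner

theorem Avoids132.apply_le_of_mem_Icc {f : Perm ℕ} (hf : Avoids132 f) {p x i : ℕ}
    (hp : f p ≤ f i) (hpx : p ≤ x) (hxi : x ≤ i) : f x ≤ f i := by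
  obtain rfl | hpx := hpx.eq_or_lt
  · exact hp
  obtain rfl | hxi := hxi.eq_or_lt
  · exact le_rfl
  exact (hf hpx hxi (lt_of_le_of_ne hp (f.injective.ne (by omega)))).le

theorem Avoids132.exists_block {f : Perm ℕ} (hf : Avoids132 f) (i : ℕ) :
    ∃ p v, p ≤ i ∧ v ≤ f i ∧ (∀ x < p, f i < f x) ∧
      ∀ x, p ≤ x ∧ x ≤ i ↔ v ≤ f x ∧ f x ≤ f i := by
  have hp : ∃ p, f p ≤ f i := ⟨i, le_rfl⟩
  have hv : ∃ v, f.symm v ≤ i := ⟨f i, (f.symm_apply_apply i).le⟩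
  refine ⟨Nat.find hp, Nat.find hv, Nat.find_min' hp le_rfl,
    Nat.find_min' hv (f.symm_apply_apply i).le, fun x hx => not_le.1 (Nat.find_min hp hx),
    fun x => ⟨fun hx => ⟨?_, ?_⟩, fun hx => ⟨?_, ?_⟩⟩⟩
  · exact Nat.find_min' hv (by rw [f.symm_apply_apply]; exact hx.2)
  · exact hf.apply_le_of_mem_Icc (Nat.find_spec hp) hx.1 hx.2
  · exact Nat.find_min' hp hx.2
  · have := hf.symm.apply_le_of_mem_Icc (i := f i) (by simpa using Nat.find_spec hv) hx.1 hx.2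
    simpa only [f.symm_apply_apply] using this

theorem sub_eq_sub_of_forall_mem_Icc_iff {f : Perm ℕ} {p i v w : ℕ}
    (h : ∀ x, p ≤ x ∧ x ≤ i ↔ v ≤ f x ∧ f x ≤ w) : i + 1 - p = w + 1 - v := by
  have : (Icc p i).map f.toEmbedding = Icc v w := by
    ext y
    simp only [mem_map_equiv, mem_Icc, h, f.apply_symm_apply]
  rw [← Nat.card_Icc, ← Nat.card_Icc, ← this, card_map]

theorem inflate_mem_av132 {p v b m : ℕ} {β τ : Perm ℕ} (hβ : β ∈ av132 b) (hτ : τ ∈ av132 m)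
    (hcorner : IsCorner p v τ) (hp : p ≤ m) (hv : v ≤ m) :
    inflate p v (b + 1) β τ ∈ av132 (m + (b + 1)) := by
  obtain ⟨hβ, hβ'⟩ := mem_av132.1 hβ
  obtain ⟨hτ, hτ'⟩ := mem_av132.1 hτ
  have hβ := permsBelow_mono (Nat.le_add_right b 1) hβ
  exact mem_av132.2 ⟨(inflate_mem_permsBelow_iff hβ hp hv).2 hτ,
    hcorner.avoids132_inflate hτ' hβ hβ'⟩

-- The block consists of all points weakly to the south-west of `(i, f i)`. Its upper right point is
-- `(i, f i)` itself, so a block of size `b + 1` is given by some `β ∈ av132 b`.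
theorem exists_inflate_eq_of_mem_av132 {n i : ℕ} {f : Perm ℕ} (hf : f ∈ av132 (n + 1))
    (hi : i ≤ n) : ∃ p v b, p + b = i ∧ v + b = f i ∧ ∃ β ∈ av132 b, ∃ τ ∈ av132 (n - b),
      IsCorner p v τ ∧ inflate p v (b + 1) β τ = f := by
  obtain ⟨hfn, hf⟩ := mem_av132.1 hf
  have hfi := apply_lt_of_mem_permsBelow hfn (Nat.lt_succ_of_le hi)
  obtain ⟨p, v, hp, hv, hlt, hblock⟩ := hf.exists_block i
  have hlen := sub_eq_sub_of_forall_mem_Icc_iff hblock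
  obtain ⟨b, rfl⟩ := Nat.exists_eq_add_of_le hp
  have hvb : v + b = f (p + b) := by omega
  obtain ⟨β, hβ, τ, rfl⟩ := exists_inflate_eq (c := b + 1) (f := f) (p := p) (v := v)
    fun x => by have := hblock x; omega
  have hβb : β b = b := by
    rw [inflate_add hβ b.lt_succ_self] at hvb
    omega
  have hβ' : β ∈ permsBelow b := mem_permsBelow.2 fun x hx => by
    obtain rfl | hx := hx.eq_or_lt
    · exact hβb
    · exact mem_permsBelow.1 hβ x hx
  have hτ : τ ∈ permsBelow (n - b) := by
    rw [(by omega : n + 1 = n - b + (b + 1))] at hfn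
    exact (inflate_mem_permsBelow_iff hβ (by omega) (by omega)).1 hfn
  refine ⟨p, v, b, rfl, hvb, β, mem_av132.2 ⟨hβ', hf.of_inflate_inner hβ⟩,
    τ, mem_av132.2 ⟨hτ, hf.of_inflate_outer hβ⟩,
    isCorner_of_avoids132_inflate hβ b.succ_pos hf fun x hx => ?_, rfl⟩
  have := hlt x hx
  rw [← hvb, ← gap_of_lt (c := b + 1) hx, inflate_gap hβ] at this
  have := gap_lt_or_le_gap v (b + 1) (τ x)
  omega

/-! ### Counting `132`-avoiding permutations and derangements -/

theorem mem_permsBelow_succ_of_mem_av132 {b : ℕ} {β : Perm ℕ} (hβ : β ∈ av132 b) :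
    β ∈ permsBelow (b + 1) :=
  permsBelow_mono (Nat.le_add_right b 1) (mem_av132.1 hβ).1

theorem inflate_add_self {p v b : ℕ} {β τ : Perm ℕ} (hβ : β ∈ av132 b) :
    inflate p v (b + 1) β τ (p + b) = v + b := by
  rw [inflate_add (mem_permsBelow_succ_of_mem_av132 hβ) b.lt_succ_self,
    mem_permsBelow.1 (mem_av132.1 hβ).1 b le_rfl]

theorem inflate_injective_of_mem_av132 {p v b : ℕ} {β β' τ τ' : Perm ℕ} (hβ : β ∈ av132 b)
    (hβ' : β' ∈ av132 b) (h : inflate p v (b + 1) β τ = inflate p v (b + 1) β' τ') :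
    β = β' ∧ τ = τ' :=
  inflate_injective (mem_permsBelow_succ_of_mem_av132 hβ) (mem_permsBelow_succ_of_mem_av132 hβ') h

theorem isCorner_zero_left {m : ℕ} {τ : Perm ℕ} (hτ : τ ∈ permsBelow m) : IsCorner 0 m τ := by
  refine ⟨fun x hx => absurd hx x.not_lt_zero, fun x hx y hy hxy => ?_⟩
  have hfix {x} (hx : m ≤ τ x) : τ x = x :=
    mem_permsBelow.1 hτ x (not_lt.1 fun h => (apply_lt_of_mem_permsBelow hτ h).not_ge hx)
  rwa [hfix hx.2, hfix hy.2]

theorem card_av132_succ (n : ℕ) :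
    #(av132 (n + 1)) = ∑ b ∈ range (n + 1), #(av132 b) * #(av132 (n - b)) := by
  simp only [← card_product, ← card_sigma]
  symm
  refine card_bij (fun x _ => inflate 0 (n - x.1) (x.1 + 1) x.2.1 x.2.2) ?_ ?_ ?_
  · rintro ⟨b, β, τ⟩ hx
    simp only [mem_sigma, mem_range, mem_product] at hx
    obtain ⟨hb, hβ, hτ⟩ := hx
    have := inflate_mem_av132 hβ hτ (isCorner_zero_left (mem_av132.1 hτ).1) (Nat.zero_le _) le_rfl
    rwa [(by omega : n - b + (b + 1) = n + 1)] at this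
  · rintro ⟨b, β, τ⟩ hx ⟨b', β', τ'⟩ hx' (h : inflate _ _ _ _ _ = inflate _ _ _ _ _)
    simp only [mem_sigma, mem_range, mem_product] at hx hx'
    obtain ⟨hb, hβ, -⟩ := hx
    obtain ⟨hb', hβ', hτ'⟩ := hx'
    have hmax := inflate_add_self (p := 0) (v := n - b) (τ := τ) hβ
    have hmax' : inflate 0 (n - b) (b + 1) β τ (0 + b') = n - b' + b' := h ▸ inflate_add_self hβ'
    obtain rfl : b = b' := by
      have := (inflate 0 (n - b) (b + 1) β τ).injective (a₁ := 0 + b) (a₂ := 0 + b')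
        (by rw [hmax, hmax']; omega)
      omega
    obtain ⟨rfl, rfl⟩ := inflate_injective_of_mem_av132 hβ hβ' h
    rfl
  · intro f hf
    have hfn := (mem_av132.1 hf).1
    have hi : f.symm n < n + 1 :=
      apply_lt_of_mem_permsBelow (symm_mem_permsBelow hfn) n.lt_succ_self
    obtain ⟨p, v, b, hp, hv, β, hβ, τ, hτ, hcorner, rfl⟩ :=
      exists_inflate_eq_of_mem_av132 hf (Nat.le_of_lt_succ hi)
    rw [apply_symm_apply] at hv
    have hp0 : p = 0 := by
      by_contra! h0
      have := hcorner.add_le_inflate_of_lt (mem_permsBelow_succ_of_mem_av132 hβ)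
        (Nat.pos_of_ne_zero h0)
      have := apply_lt_of_mem_permsBelow hfn (x := 0) (by omega)
      omega
    obtain rfl : v = n - b := by omega
    subst hp0
    exact ⟨⟨b, β, τ⟩, by simp only [mem_sigma, mem_range, mem_product]; exact ⟨by omega, hβ, hτ⟩,
      rfl⟩

theorem card_av132 (n : ℕ) : #(av132 n) = catalan n := by
  induction n using Nat.strong_induction_on with
  | _ n ih =>
    cases n with
    | zero =>
      have : av132 0 = {1} := by
        ext f
        rw [mem_av132, mem_permsBelow, mem_singleton]
        refine ⟨fun h => Equiv.ext fun x => h.1 x x.zero_le, ?_⟩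
        rintro rfl
        exact ⟨fun _ _ => rfl, fun _ _ _ _ hbc _ => hbc⟩
      rw [this, card_singleton, catalan_zero]
    | succ n =>
      rw [card_av132_succ, catalan_succ,
        Fin.sum_univ_eq_sum_range (fun b => catalan b * catalan (n - b))]
      refine sum_congr rfl fun b hb => ?_
      rw [ih b (mem_range.1 hb), ih (n - b) (by omega)]

theorem isLeast_inflate_le {p v b : ℕ} {β τ : Perm ℕ} (hβ : β ∈ av132 b)
    (hcorner : IsCorner p v τ) : IsLeast {x | inflate p v (b + 1) β τ x ≤ v + b} p := by
  have hβ := mem_permsBelow_succ_of_mem_av132 hβ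
  constructor
  · have := apply_lt_of_mem_permsBelow hβ b.succ_pos
    have := inflate_add (p := p) (v := v) (τ := τ) hβ b.succ_pos
    rw [add_zero] at this
    rw [Set.mem_ofPred_eq, this]
    omega
  · intro x (hx : inflate p v (b + 1) β τ x ≤ v + b)
    by_contra! hxp
    have := hcorner.add_le_inflate_of_lt hβ hxp
    omega

theorem isLeast_inflate_eq_self {k b : ℕ} {β τ : Perm ℕ} (hβ : β ∈ der132 b)
    (hcorner : IsCorner k k τ) : IsLeast {x | inflate k k (b + 1) β τ x = x} (k + b) := by
  obtain ⟨hβ, hne⟩ := mem_der132.1 hβ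
  refine ⟨inflate_add_self hβ, fun x (hx : _ = _) => ?_⟩
  have hβ := mem_permsBelow_succ_of_mem_av132 hβ
  by_contra! hlt
  obtain hxk | hkx := lt_or_ge x k
  · have := hcorner.add_le_inflate_of_lt hβ hxk
    omega
  · obtain ⟨y, rfl⟩ := Nat.exists_eq_add_of_le hkx
    rw [inflate_add hβ (by omega)] at hx
    exact hne y (by omega) (by omega)

theorem inflate_corner_injective {b b' : ℕ} {β τ β' τ' : Perm ℕ} (hβ : β ∈ der132 b)
    (hβ' : β' ∈ der132 b') (hτ : Avoids132 τ) (hτ' : Avoids132 τ')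
    (h : inflate (corner τ) (corner τ) (b + 1) β τ =
      inflate (corner τ') (corner τ') (b' + 1) β' τ') : b = b' ∧ β = β' ∧ τ = τ' := by
  have hβav := (mem_der132.1 hβ).1
  have hβav' := (mem_der132.1 hβ').1
  have hsum := (isLeast_inflate_eq_self hβ (isCorner_corner hτ)).unique
    (h ▸ isLeast_inflate_eq_self hβ' (isCorner_corner hτ'))
  have hcorner := (isLeast_inflate_le hβav (isCorner_corner hτ)).unique
    (h ▸ hsum ▸ isLeast_inflate_le hβav' (isCorner_corner hτ'))
  obtain rfl : b = b' := by omega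
  rw [← hcorner] at h
  exact ⟨rfl, inflate_injective_of_mem_av132 hβav hβav' h⟩

theorem inflate_corner_mem_av132 {n b : ℕ} {β τ : Perm ℕ} (hb : b ≤ n) (hβ : β ∈ av132 b)
    (hτ : τ ∈ av132 (n - b)) :
    inflate (corner τ) (corner τ) (b + 1) β τ ∈ av132 (n + 1) := by
  obtain ⟨hτn, hτ'⟩ := mem_av132.1 hτ
  have := inflate_mem_av132 hβ hτ (isCorner_corner hτ') (corner_le hτn) (corner_le hτn)
  rwa [(by omega : n - b + (b + 1) = n + 1)] at this

theorem exists_inflate_corner_eq {n i : ℕ} {f : Perm ℕ} (hf : f ∈ av132 (n + 1)) (hi : i ≤ n)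
    (hfi : f i = i) : ∃ b ≤ n, ∃ β ∈ av132 b, ∃ τ ∈ av132 (n - b), corner τ + b = i ∧
      inflate (corner τ) (corner τ) (b + 1) β τ = f := by
  obtain ⟨k, v, b, hk, hv, β, hβ, τ, hτ, hcorner, rfl⟩ := exists_inflate_eq_of_mem_av132 hf hi
  obtain rfl : v = k := by omega
  obtain rfl := hcorner.diag_unique (isCorner_corner (mem_av132.1 hτ).2)
  exact ⟨b, by omega, β, hβ, τ, hτ, hk, rfl⟩

theorem card_filter_exists_fixed_av132 (n : ℕ) :
    #{f ∈ av132 (n + 1) | ¬∀ x < n + 1, f x ≠ x} =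
      ∑ b ∈ range (n + 1), #(der132 b) * #(av132 (n - b)) := by
  simp only [← card_product, ← card_sigma]
  symm
  refine card_bij (fun x _ => inflate (corner x.2.2) (corner x.2.2) (x.1 + 1) x.2.1 x.2.2) ?_ ?_ ?_
  · rintro ⟨b, β, τ⟩ hx
    simp only [mem_sigma, mem_range, mem_product] at hx
    obtain ⟨hb, hβ, hτ⟩ := hx
    have hβ := (mem_der132.1 hβ).1
    refine mem_filter.2 ⟨inflate_corner_mem_av132 (Nat.le_of_lt_succ hb) hβ hτ, fun hne => ?_⟩
    have := corner_le (mem_av132.1 hτ).1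
    exact hne (corner τ + b) (by omega) (inflate_add_self hβ)
  · rintro ⟨b, β, τ⟩ hx ⟨b', β', τ'⟩ hx' (h : inflate _ _ _ _ _ = inflate _ _ _ _ _)
    simp only [mem_sigma, mem_product] at hx hx'
    obtain ⟨rfl, rfl, rfl⟩ := inflate_corner_injective hx.2.1 hx'.2.1 (mem_av132.1 hx.2.2).2
      (mem_av132.1 hx'.2.2).2 h
    rfl
  · intro f hf
    obtain ⟨hf, hfix⟩ := mem_filter.1 hf
    have hfix : ∃ x, x < n + 1 ∧ f x = x := by simpa using hfix
    obtain ⟨hi, hfi⟩ := Nat.find_spec hfix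
    have hmin {x} (hx : x < Nat.find hfix) : f x ≠ x := fun hfx =>
      Nat.find_min hfix hx ⟨hx.trans hi, hfx⟩
    obtain ⟨b, hb, β, hβ, τ, hτ, hsum, hinfl⟩ :=
      exists_inflate_corner_eq hf (Nat.le_of_lt_succ hi) hfi
    have hβ' : β ∈ der132 b := mem_der132.2 ⟨hβ, fun y hy hβy => hmin (x := corner τ + y)
      (by omega) (by
        rw [← hinfl, inflate_add (mem_permsBelow_succ_of_mem_av132 hβ) (by omega), hβy])⟩
    exact ⟨⟨b, β, τ⟩, by
      simp only [mem_sigma, mem_range, mem_product]; exact ⟨by omega, hβ', hτ⟩, hinfl⟩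

theorem catalan_eq_card_der132_add (n : ℕ) :
    catalan (n + 1) = #(der132 (n + 1)) + ∑ b ∈ range (n + 1), #(der132 b) * catalan (n - b) := by
  simp only [← card_av132]
  rw [← card_filter_exists_fixed_av132, der132]
  exact (card_filter_add_card_filter_not _).symm

/-- The point `(i, i)` is a left-to-right minimum of the word `f 0, …, f (n - 1)`. -/
def IsFixedMin (n : ℕ) (f : Perm ℕ) (i : ℕ) : Prop :=
  i < n ∧ f i = i ∧ ∀ x < i, i < f x

open Classical in
theorem card_filter_exists_isFixedMin_av132_le (n : ℕ) :
    #{f ∈ av132 (n + 1) | ∃ i, IsFixedMin (n + 1) f i} ≤ catalan n := by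
  rw [← card_av132]
  refine card_le_card_of_surjOn (fun τ => inflate (corner τ) (corner τ) 1 1 τ) fun f hf => ?_
  obtain ⟨hf, i, hi, hfi, hmin⟩ := mem_filter.1 (mem_coe.1 hf)
  obtain ⟨b, hb, β, hβ, τ, hτ, hsum, rfl⟩ :=
    exists_inflate_corner_eq hf (Nat.le_of_lt_succ hi) hfi
  obtain rfl : b = 0 := by
    by_contra! hb0
    have := hmin (corner τ) (by omega)
    have := (isLeast_inflate_le hβ (isCorner_corner (mem_av132.1 hτ).2)).1
    simp only [Set.mem_ofPred_eq] at this
    omega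
  have hβ1 : β = 1 := Equiv.ext fun x => mem_permsBelow.1 (mem_av132.1 hβ).1 x x.zero_le
  exact ⟨τ, hτ, by rw [hβ1]⟩

theorem card_der132_zero : #(der132 0) = 1 := by
  rw [der132, filter_true_of_mem fun _ _ x hx => absurd hx x.not_lt_zero, card_av132, catalan_zero]

theorem catalan_succ_eq_two_mul_card_der132_add (n : ℕ) :
    catalan (n + 1) = 2 * #(der132 (n + 1)) + #(der132 n) := by
  let C : PowerSeries ℤ := PowerSeries.map (Nat.castRingHom ℤ) PowerSeries.catalanSeries
  let F : PowerSeries ℤ := PowerSeries.mk fun n => (#(der132 n) : ℤ)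
  have hcoeff (n) : PowerSeries.coeff n C = catalan n := by
    simp only [C, PowerSeries.coeff_map, PowerSeries.catalanSeries_coeff, eq_natCast]
  have hC : C = C ^ 2 * PowerSeries.X + 1 := by
    have := congrArg (PowerSeries.map (Nat.castRingHom ℤ))
      PowerSeries.catalanSeries_sq_mul_X_add_one
    simpa only [map_add, map_mul, map_pow, map_one, PowerSeries.map_X] using this.symm
  have hF : C = F + F * C * PowerSeries.X := by
    ext n
    cases n with
    | zero =>
      rw [map_add, PowerSeries.coeff_zero_mul_X, hcoeff, PowerSeries.coeff_mk, card_der132_zero,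
        catalan_zero, add_zero]
    | succ n =>
      rw [map_add, PowerSeries.coeff_succ_mul_X, PowerSeries.coeff_mul,
        Nat.sum_antidiagonal_eq_sum_range_succ_mk]
      simp only [hcoeff, F, PowerSeries.coeff_mk]
      exact_mod_cast catalan_eq_card_der132_add n
  have hFC : F * PowerSeries.X + 2 * F = C + 1 := by
    have hne : 1 + C * PowerSeries.X ≠ 0 := fun h => by
      simpa using congrArg PowerSeries.constantCoeff h
    apply mul_right_cancel₀ hne
    linear_combination hC - (2 + PowerSeries.X) * hF
  have := congrArg (PowerSeries.coeff (n + 1)) hFC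
  rw [map_add, map_add, two_mul, map_add, PowerSeries.coeff_succ_mul_X, hcoeff,
    PowerSeries.coeff_one, if_neg n.succ_ne_zero] at this
  simp only [F, PowerSeries.coeff_mk] at this
  omega

/-! ### Left-to-right minima -/

/-- The left-to-right minima of `f`, as points `(i, f i)` of its graph. -/
def lrMin (f : Perm ℕ) : Set (ℕ × ℕ) :=
  {q | f q.1 = q.2 ∧ ∀ x < q.1, q.2 < f x}

theorem lrMin_subset_mul_swap {f : Perm ℕ} {a j k : ℕ} (haj : a < j) (hjk : j < k)
    (hj : f a < f j) (hk : f a < f k) : lrMin f ⊆ lrMin (f * swap j k) := by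
  rintro ⟨x, v⟩ ⟨rfl : f x = v, hmin : ∀ y < x, f x < f y⟩
  have hxj : x ≠ j := by
    rintro rfl
    exact hj.asymm (hmin a haj)
  have hxk : x ≠ k := by
    rintro rfl
    exact hk.asymm (hmin a (haj.trans hjk))
  refine ⟨by rw [Perm.mul_apply, swap_apply_of_ne_of_ne hxj hxk], fun y (hy : y < x) => ?_⟩
  rw [Perm.mul_apply]
  obtain rfl | hyj := eq_or_ne y j
  · rw [swap_apply_left]
    exact (hmin a (haj.trans hy)).trans hk
  obtain rfl | hyk := eq_or_ne y k
  · rw [swap_apply_right]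
    exact hmin j (hjk.trans hy)
  · rw [swap_apply_of_ne_of_ne hyj hyk]
    exact hmin y hy

theorem lrMin_mul_swap {f : Perm ℕ} {a j k : ℕ} (haj : a < j) (hjk : j < k)
    (hj : f a < f j) (hk : f a < f k) : lrMin (f * swap j k) = lrMin f := by
  refine (lrMin_subset_mul_swap haj hjk hj hk).antisymm' ?_
  have hsub := lrMin_subset_mul_swap (f := f * swap j k) haj hjk
  simp only [Perm.mul_apply, swap_apply_left, swap_apply_right, mul_assoc, swap_mul_self, mul_one,
    swap_apply_of_ne_of_ne haj.ne (haj.trans hjk).ne] at hsub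
  exact hsub hk hj

theorem sum_mul_mul_swap_lt {n j k : ℕ} {f : Perm ℕ} (hjk : j < k) (hk : k < n) (h : f j < f k) :
    ∑ x ∈ range n, x * (f * swap j k) x < ∑ x ∈ range n, x * f x := by
  have hj' : j ∈ range n := mem_range.2 (hjk.trans hk)
  have hk' : k ∈ (range n).erase j := mem_erase.2 ⟨hjk.ne', mem_range.2 hk⟩
  simp only [← add_sum_erase _ _ hj', ← add_sum_erase _ _ hk', ← add_assoc, Perm.mul_apply,
    swap_apply_left, swap_apply_right]
  refine add_lt_add_of_lt_of_le (mul_add_mul_lt_mul_add_mul hjk h) (sum_le_sum fun x hx => ?_)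
  simp only [mem_erase] at hx
  rw [swap_apply_of_ne_of_ne hx.2.1 hx.1]

-- Swapping the last two entries of an occurrence of `123` preserves the left-to-right minima.
theorem exists_mem_av123_lrMin_eq {n : ℕ} {f : Perm ℕ} (hf : f ∈ permsBelow n) :
    ∃ g ∈ av123 n, lrMin g = lrMin f := by
  obtain ⟨g, hg, hmin⟩ := exists_min_image {g ∈ permsBelow n | lrMin g = lrMin f}
    (fun g => ∑ x ∈ range n, x * g x) ⟨f, mem_filter.2 ⟨hf, rfl⟩⟩
  obtain ⟨hg, hgf⟩ := mem_filter.1 hg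
  refine ⟨g, mem_av123.2 ⟨hg, fun a b c hab hbc hc hlt => ?_⟩, hgf⟩
  by_contra! hle
  have hlt' : g b < g c := lt_of_le_of_ne hle (g.injective.ne hbc.ne)
  have hswap := (lrMin_mul_swap hab hbc hlt (hlt.trans hlt')).trans hgf
  have hmem := mul_mem_permsBelow hg (swap_mem_permsBelow (hbc.trans hc) hc)
  exact (sum_mul_mul_swap_lt hbc hc hlt').not_ge (hmin _ (mem_filter.2 ⟨hmem, hswap⟩))

theorem exists_mem_av132_lrMin_eq {n : ℕ} {f : Perm ℕ} (hf : f ∈ permsBelow n) :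
    ∃ g ∈ av132 n, lrMin g = lrMin f := by
  obtain ⟨g, hg, hmax⟩ := exists_max_image {g ∈ permsBelow n | lrMin g = lrMin f}
    (fun g => ∑ x ∈ range n, x * g x) ⟨f, mem_filter.2 ⟨hf, rfl⟩⟩
  obtain ⟨hg, hgf⟩ := mem_filter.1 hg
  refine ⟨g, mem_av132.2 ⟨hg, Avoids132.of_lt hg fun a b c hab hbc hc hlt => ?_⟩, hgf⟩
  by_contra! hle
  have hlt' : g c < g b := lt_of_le_of_ne hle (g.injective.ne hbc.ne')
  have hswap := (lrMin_mul_swap hab hbc (hlt.trans hlt') hlt).trans hgf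
  have hmem := mul_mem_permsBelow hg (swap_mem_permsBelow (hbc.trans hc) hc)
  have hsum := sum_mul_mul_swap_lt (f := g * swap b c) hbc hc (by simpa using hlt')
  rw [mul_assoc, swap_mul_self, mul_one] at hsum
  exact hsum.not_ge (hmax _ (mem_filter.2 ⟨hmem, hswap⟩))

-- The value `g p` completes a `123` in `f`, and the value `f p` completes a `132` in `g`.
theorem not_avoids_of_lrMin_eq {n p : ℕ} {f g : Perm ℕ} (hf : f ∈ permsBelow n)
    (hg : g ∈ permsBelow n) (h : lrMin f = lrMin g) (hp : ∀ x < p, f x = g x) (hlt : f p < g p) :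
    ¬Avoids123 n f ∧ ¬Avoids132 g := by
  have hpn : p < n := by
    by_contra! hnp
    exact hlt.ne ((mem_permsBelow.1 hf p hnp).trans (mem_permsBelow.1 hg p hnp).symm)
  obtain ⟨q, hqp, hq⟩ : ∃ q < p, f q < f p := by
    by_contra! hle
    have hmem : (p, f p) ∈ lrMin f :=
      ⟨rfl, fun x hx => lt_of_le_of_ne (hle x hx) (f.injective.ne (Nat.ne_of_gt hx))⟩
    rw [h] at hmem
    exact hlt.ne' hmem.1
  have later {f g : Perm ℕ} (hp : ∀ x < p, f x = g x) (hne : f p ≠ g p) : p < f.symm (g p) := by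
    by_contra! hle
    obtain hlt | heq := hle.lt_or_eq
    · have := hp _ hlt
      rw [f.apply_symm_apply] at this
      exact hlt.ne (g.injective this).symm
    · exact hne (by rw [← heq, f.apply_symm_apply, heq])
  constructor
  · intro hav
    have hr := apply_lt_of_mem_permsBelow (symm_mem_permsBelow hf)
      (apply_lt_of_mem_permsBelow hg hpn)
    have := hav hqp (later hp hlt.ne) hr hq
    rw [f.apply_symm_apply] at this
    exact this.asymm hlt
  · intro hav
    have := hav hqp (later (fun x hx => (hp x hx).symm) hlt.ne')
    rw [g.apply_symm_apply, ← hp q hqp] at this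
    exact (this hq).asymm hlt

theorem exists_forall_lt_eq_and_ne {f g : Perm ℕ} (h : f ≠ g) :
    ∃ p, (∀ x < p, f x = g x) ∧ f p ≠ g p := by
  have hex := DFunLike.ne_iff.1 h
  exact ⟨Nat.find hex, fun x hx => not_not.1 (Nat.find_min hex hx), Nat.find_spec hex⟩

theorem injOn_lrMin_av123 (n : ℕ) : Set.InjOn lrMin (av123 n : Set (Perm ℕ)) := by
  intro f hf g hg h
  obtain ⟨hf, hfav⟩ := mem_av123.1 hf
  obtain ⟨hg, hgav⟩ := mem_av123.1 hg
  by_contra hne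
  obtain ⟨p, hp, hne⟩ := exists_forall_lt_eq_and_ne hne
  obtain hlt | hlt := hne.lt_or_gt
  · exact (not_avoids_of_lrMin_eq hf hg h hp hlt).1 hfav
  · exact (not_avoids_of_lrMin_eq hg hf h.symm (fun x hx => (hp x hx).symm) hlt).1 hgav

theorem injOn_lrMin_av132 (n : ℕ) : Set.InjOn lrMin (av132 n : Set (Perm ℕ)) := by
  intro f hf g hg h
  obtain ⟨hf, hfav⟩ := mem_av132.1 hf
  obtain ⟨hg, hgav⟩ := mem_av132.1 hg
  by_contra hne
  obtain ⟨p, hp, hne⟩ := exists_forall_lt_eq_and_ne hne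
  obtain hlt | hlt := hne.lt_or_gt
  · exact (not_avoids_of_lrMin_eq hf hg h hp hlt).2 hgav
  · exact (not_avoids_of_lrMin_eq hg hf h.symm (fun x hx => (hp x hx).symm) hlt).2 hfav

open Classical in
theorem card_filter_lrMin_av123 (n : ℕ) (P : Set (ℕ × ℕ) → Prop) :
    #{f ∈ av123 n | P (lrMin f)} = #{f ∈ av132 n | P (lrMin f)} := by
  rw [← card_image_of_injOn ((injOn_lrMin_av123 n).mono (coe_subset.2 (filter_subset _ _))),
    ← card_image_of_injOn ((injOn_lrMin_av132 n).mono (coe_subset.2 (filter_subset _ _)))]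
  congr 1
  ext M
  simp only [mem_image, mem_filter]
  constructor
  · rintro ⟨f, ⟨hf, hP⟩, rfl⟩
    obtain ⟨g, hg, hgf⟩ := exists_mem_av132_lrMin_eq (mem_av123.1 hf).1
    exact ⟨g, ⟨hg, hgf ▸ hP⟩, hgf⟩
  · rintro ⟨f, ⟨hf, hP⟩, rfl⟩
    obtain ⟨g, hg, hgf⟩ := exists_mem_av123_lrMin_eq (mem_av132.1 hf).1
    exact ⟨g, ⟨hg, hgf ▸ hP⟩, hgf⟩

theorem card_av123 (n : ℕ) : #(av123 n) = catalan n := by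
  simpa only [filter_true, card_av132] using card_filter_lrMin_av123 n fun _ => True

/-! ### Fixed points of `123`-avoiding permutations -/

/-- The point `(i, i)` is a right-to-left maximum of the word `f 0, …, f (n - 1)`. -/
def IsFixedMax (n : ℕ) (f : Perm ℕ) (i : ℕ) : Prop :=
  i < n ∧ f i = i ∧ ∀ x, i < x → x < n → f x < i

open Classical in
/-- The `123`-avoiding permutations with a fixed point that is a left-to-right minimum. -/
noncomputable def fixedMin (n : ℕ) : Finset (Perm ℕ) :=
  {f ∈ av123 n | ∃ i, IsFixedMin n f i}

open Classical in
/-- The `123`-avoiding permutations with a fixed point that is a right-to-left maximum. -/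
noncomputable def fixedMax (n : ℕ) : Finset (Perm ℕ) :=
  {f ∈ av123 n | ∃ i, IsFixedMax n f i}

open Classical in
/-- The `123`-avoiding permutations with fixed points of both kinds. -/
noncomputable def fixedMinMax (n : ℕ) : Finset (Perm ℕ) :=
  fixedMin n ∩ fixedMax n

theorem mem_fixedMin {n : ℕ} {f : Perm ℕ} :
    f ∈ fixedMin n ↔ f ∈ av123 n ∧ ∃ i, IsFixedMin n f i := by
  simp only [fixedMin, mem_filter]

theorem mem_fixedMax {n : ℕ} {f : Perm ℕ} :
    f ∈ fixedMax n ↔ f ∈ av123 n ∧ ∃ i, IsFixedMax n f i := by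
  simp only [fixedMax, mem_filter]

theorem card_fixedMin_succ_le (n : ℕ) : #(fixedMin (n + 1)) ≤ catalan n :=
  (card_filter_lrMin_av123 (n + 1) fun M => ∃ i, i < n + 1 ∧ (i, i) ∈ M).trans_le
    (card_filter_exists_isFixedMin_av132_le n)

/-- The reversal of `{0, …, n - 1}`. -/
def rev (n : ℕ) : Perm ℕ :=
  Function.Involutive.toPerm (fun x => if x < n then n - 1 - x else x) fun x => by
    dsimp only
    split_ifs <;> omega

/-- The reverse-complement of `f ∈ permsBelow n`: its graph is rotated by 180 degrees. -/
def revCompl (n : ℕ) (f : Perm ℕ) : Perm ℕ :=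
  rev n * f * rev n

theorem rev_of_lt {n x : ℕ} (hx : x < n) : rev n x = n - 1 - x :=
  if_pos hx

theorem revCompl_injective (n : ℕ) : Function.Injective (revCompl n) := fun _ _ h =>
  mul_left_cancel (mul_right_cancel h)

theorem revCompl_apply {n x : ℕ} {f : Perm ℕ} (hf : f ∈ permsBelow n) (hx : x < n) :
    revCompl n f x = n - 1 - f (n - 1 - x) := by
  rw [revCompl, Perm.mul_apply, Perm.mul_apply, rev_of_lt hx,
    rev_of_lt (apply_lt_of_mem_permsBelow hf (by omega))]

theorem revCompl_mem_av123 {n : ℕ} {f : Perm ℕ} (hf : f ∈ av123 n) : revCompl n f ∈ av123 n := by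
  obtain ⟨hf, hav⟩ := mem_av123.1 hf
  have hrev : rev n ∈ permsBelow n := mem_permsBelow.2 fun x hx => if_neg hx.not_gt
  refine mem_av123.2 ⟨mul_mem_permsBelow (mul_mem_permsBelow hrev hf) hrev,
    fun a b c hab hbc hc hlt => ?_⟩
  rw [revCompl_apply hf (by omega), revCompl_apply hf (by omega)] at hlt ⊢
  have := @hav (n - 1 - c) (n - 1 - b) (n - 1 - a) (by omega) (by omega) (by omega)
  have := apply_lt_of_mem_permsBelow hf (x := n - 1 - b) (by omega)
  have := apply_lt_of_mem_permsBelow hf (x := n - 1 - c) (by omega)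
  have := f.injective.ne (by omega : n - 1 - c ≠ n - 1 - b)
  omega

theorem IsFixedMin.revCompl {n i : ℕ} {f : Perm ℕ} (hf : f ∈ permsBelow n)
    (h : IsFixedMin n f i) : IsFixedMax n (revCompl n f) (n - 1 - i) := by
  obtain ⟨hi, hfi, hmin⟩ := h
  refine ⟨by omega, ?_, fun x hx hxn => ?_⟩
  · rw [revCompl_apply hf (by omega), (by omega : n - 1 - (n - 1 - i) = i), hfi]
  · have := hmin (n - 1 - x) (by omega)
    have := apply_lt_of_mem_permsBelow hf (x := n - 1 - x) (by omega)
    rw [revCompl_apply hf hxn]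
    omega

theorem IsFixedMax.revCompl {n i : ℕ} {f : Perm ℕ} (hf : f ∈ permsBelow n)
    (h : IsFixedMax n f i) : IsFixedMin n (revCompl n f) (n - 1 - i) := by
  obtain ⟨hi, hfi, hmax⟩ := h
  refine ⟨by omega, ?_, fun x hx => ?_⟩
  · rw [revCompl_apply hf (by omega), (by omega : n - 1 - (n - 1 - i) = i), hfi]
  · have := hmax (n - 1 - x) (by omega) (by omega)
    rw [revCompl_apply hf (by omega)]
    omega

theorem card_fixedMax_succ_le (n : ℕ) : #(fixedMax (n + 1)) ≤ catalan n := by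
  refine (card_le_card_of_injOn (revCompl (n + 1)) (fun f hf => ?_)
    (revCompl_injective _).injOn).trans (card_fixedMin_succ_le n)
  obtain ⟨hf, i, hi⟩ := mem_fixedMax.1 hf
  exact mem_fixedMin.2 ⟨revCompl_mem_av123 hf, _, hi.revCompl (mem_av123.1 hf).1⟩

open Classical in
theorem av123_subset (n : ℕ) : av123 n ⊆ der123 n ∪ (fixedMin n ∪ fixedMax n) := by
  intro f hf
  simp only [mem_union, der123, mem_filter, mem_fixedMin, mem_fixedMax, hf, true_and]
  by_contra! ⟨⟨i, hi, hfi⟩, hmin, hmax⟩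
  refine hmin i ⟨hi, hfi, fun x hxi => ?_⟩
  have hne : f x ≠ f i := f.injective.ne hxi.ne
  by_contra! hle
  exact hmax i ⟨hi, hfi, fun y hiy hy => by
    have := (mem_av123.1 hf).2 hxi hiy hy (by omega)
    rwa [hfi] at this⟩

theorem catalan_succ_add_card_fixedMinMax_le (n : ℕ) :
    catalan (n + 1) + #(fixedMinMax (n + 1)) ≤
      #(der123 (n + 1)) + 2 * catalan n := by
  classical
  have hcard := (card_le_card (av123_subset (n + 1))).trans (card_union_le _ _)
  have hunion := card_union_add_card_inter (fixedMin (n + 1)) (fixedMax (n + 1))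
  rw [← fixedMinMax] at hunion
  have hmin := card_fixedMin_succ_le n
  have hmax := card_fixedMax_succ_le n
  rw [card_av123] at hcard
  omega

/-! ### Counting pairs of fixed points -/

open Classical in
/-- The `123`-avoiding permutations in which `i` is a fixed left-to-right minimum and `j` a fixed
right-to-left maximum. -/
noncomputable def fixedPair (n i j : ℕ) : Finset (Perm ℕ) :=
  {f ∈ av123 n | IsFixedMin n f i ∧ IsFixedMax n f j}

theorem mem_fixedPair {n i j : ℕ} {f : Perm ℕ} :
    f ∈ fixedPair n i j ↔ f ∈ av123 n ∧ IsFixedMin n f i ∧ IsFixedMax n f j := by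
  simp only [fixedPair, mem_filter]

theorem IsFixedMin.unique {n i j : ℕ} {f : Perm ℕ} (hi : IsFixedMin n f i)
    (hj : IsFixedMin n f j) : i = j := by
  have hij := hi.2.2 j
  have hji := hj.2.2 i
  rw [hi.2.1] at hji
  rw [hj.2.1] at hij
  omega

theorem IsFixedMax.unique {n i j : ℕ} {f : Perm ℕ} (hi : IsFixedMax n f i)
    (hj : IsFixedMax n f j) : i = j := by
  have hij := hi.2.2 j
  have hji := hj.2.2 i
  have hin := hi.1
  have hjn := hj.1
  rw [hi.2.1] at hji
  rw [hj.2.1] at hij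
  omega

theorem sum_card_fixedPair_le (n : ℕ) (S : Finset (ℕ × ℕ)) :
    ∑ q ∈ S, #(fixedPair n q.1 q.2) ≤ #(fixedMinMax n) := by
  classical
  rw [← card_biUnion]
  · refine card_le_card (biUnion_subset.2 fun q _ f hf => ?_)
    obtain ⟨hf, hmin, hmax⟩ := mem_fixedPair.1 hf
    exact mem_inter.2 ⟨mem_fixedMin.2 ⟨hf, _, hmin⟩, mem_fixedMax.2 ⟨hf, _, hmax⟩⟩
  · refine fun q _ r _ hne => disjoint_left.2 fun f hq hr => hne ?_
    obtain ⟨-, hqmin, hqmax⟩ := mem_fixedPair.1 hq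
    obtain ⟨-, hrmin, hrmax⟩ := mem_fixedPair.1 hr
    exact Prod.ext (hqmin.unique hrmin) (hqmax.unique hrmax)

theorem card_fixedPair_le_card_fixedPair_rev (n i j : ℕ) :
    #(fixedPair n i j) ≤ #(fixedPair n (n - 1 - j) (n - 1 - i)) := by
  refine card_le_card_of_injOn (revCompl n) (fun f hf => ?_) (revCompl_injective n).injOn
  obtain ⟨hf, hmin, hmax⟩ := mem_fixedPair.1 hf
  have hperm := (mem_av123.1 hf).1
  exact mem_fixedPair.2 ⟨revCompl_mem_av123 hf, hmax.revCompl hperm, hmin.revCompl hperm⟩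

/-- The skew sum of `τ ∈ permsBelow m` and `ρ ∈ permsBelow c`: the word of `τ`, raised by `c`,
followed by the word of `ρ`. -/
noncomputable def skewSum (m c : ℕ) (τ ρ : Perm ℕ) : Perm ℕ :=
  inflate m 0 c ρ τ

theorem skewSum_of_lt {m c x : ℕ} {τ ρ : Perm ℕ} (hρ : ρ ∈ permsBelow c) (hx : x < m) :
    skewSum m c τ ρ x = τ x + c := by
  have := inflate_gap (p := m) (v := 0) (τ := τ) hρ x
  rwa [gap_of_lt hx, gap_of_le (Nat.zero_le _)] at this

theorem skewSum_add {m c y : ℕ} {τ ρ : Perm ℕ} (hρ : ρ ∈ permsBelow c) (hy : y < c) :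
    skewSum m c τ ρ (m + y) = ρ y :=
  (inflate_add hρ hy).trans (Nat.zero_add _)

theorem skewSum_mem_av123 {m c : ℕ} {τ ρ : Perm ℕ} (hτ : τ ∈ av123 m) (hρ : ρ ∈ av123 c) :
    skewSum m c τ ρ ∈ av123 (m + c) := by
  obtain ⟨hτ, hτav⟩ := mem_av123.1 hτ
  obtain ⟨hρ, hρav⟩ := mem_av123.1 hρ
  refine mem_av123.2 ⟨(inflate_mem_permsBelow_iff hρ le_rfl (Nat.zero_le m)).2 hτ,
    fun a b d hab hbd hd hlt => ?_⟩
  obtain hb | hb := lt_or_ge b m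
  · rw [skewSum_of_lt hρ (hab.trans hb), skewSum_of_lt hρ hb] at hlt
    rw [skewSum_of_lt hρ hb]
    obtain hdm | hdm := lt_or_ge d m
    · rw [skewSum_of_lt hρ hdm]
      have := hτav hab hbd hdm (by omega)
      omega
    · obtain ⟨d, rfl⟩ := Nat.exists_eq_add_of_le hdm
      rw [skewSum_add hρ (by omega)]
      have := apply_lt_of_mem_permsBelow hρ (x := d) (by omega)
      omega
  · obtain ⟨b, rfl⟩ := Nat.exists_eq_add_of_le hb
    obtain ⟨d, rfl⟩ := Nat.exists_eq_add_of_le (hb.trans hbd.le)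
    rw [skewSum_add hρ (by omega)] at hlt ⊢
    rw [skewSum_add hρ (by omega)]
    obtain ha | ha := lt_or_ge a m
    · rw [skewSum_of_lt hρ ha] at hlt
      have := apply_lt_of_mem_permsBelow hρ (x := b) (by omega)
      omega
    · obtain ⟨a, rfl⟩ := Nat.exists_eq_add_of_le ha
      rw [skewSum_add hρ (by omega)] at hlt
      exact hρav (by omega) (by omega) (by omega) hlt

/-- The graph of `insertFixed k f` arises from that of `f` by inserting the fixed point `(k, k)`. -/
noncomputable def insertFixed (k : ℕ) (f : Perm ℕ) : Perm ℕ :=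
  inflate k k 1 1 f

section InsertFixed

variable {k m : ℕ} {f : Perm ℕ}

theorem insertFixed_gap (k : ℕ) (f : Perm ℕ) (x : ℕ) :
    insertFixed k f (gap k 1 x) = gap k 1 (f x) :=
  inflate_gap (one_mem_permsBelow 1) x

theorem insertFixed_self (k : ℕ) (f : Perm ℕ) : insertFixed k f k = k :=
  inflate_add (one_mem_permsBelow 1) Nat.one_pos

theorem insertFixed_injective (k : ℕ) : Function.Injective (insertFixed k) := fun _ _ h =>
  (inflate_injective (one_mem_permsBelow 1) (one_mem_permsBelow 1) h).2

theorem exists_gap_one_eq_or_eq (k x : ℕ) : (∃ y, gap k 1 y = x) ∨ k = x := by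
  obtain h | ⟨y, hy, rfl⟩ := exists_gap_eq_or_exists_add_eq k 1 x
  · exact .inl h
  · exact .inr (by omega)

theorem lt_gap_one_iff {x : ℕ} : k < gap k 1 x ↔ k ≤ x := by
  have := gap_lt_or_le_gap k 1 x
  omega

-- The other two points of a `123` that uses the new point `(k, k)` lie to its south-west or
-- north-east, and they form an ascent.
theorem insertFixed_mem_av123 (hf : f ∈ av123 m) (hk : k ≤ m)
    (h : ∀ ⦃x y⦄, x < y → y < m → (x < k ↔ f x < k) → (y < k ↔ f y < k) → f y < f x) :
    insertFixed k f ∈ av123 (m + 1) := by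
  obtain ⟨hf, hav⟩ := mem_av123.1 hf
  refine mem_av123.2 ⟨(inflate_mem_permsBelow_iff (one_mem_permsBelow 1) hk hk).2 hf,
    fun a b c hab hbc hc hlt => ?_⟩
  have lt_iff {x y : ℕ} : gap k 1 x < gap k 1 y ↔ x < y := (strictMono_gap k 1).lt_iff_lt
  by_contra hnot
  obtain ⟨b, rfl⟩ | rfl := exists_gap_one_eq_or_eq k b
  · obtain ⟨a, rfl⟩ | rfl := exists_gap_one_eq_or_eq k a
    · obtain ⟨c, rfl⟩ | rfl := exists_gap_one_eq_or_eq k c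
      · simp only [insertFixed_gap, lt_iff] at hab hbc hlt hnot
        exact hnot (hav hab hbc ((gap_lt_add_iff hk).1 hc) hlt)
      · simp only [insertFixed_gap, insertFixed_self, lt_iff, gap_lt_iff, lt_gap_one_iff]
          at hab hbc hlt hnot
        have := h hab (by omega) (by omega) (by omega)
        omega
    · obtain ⟨c, rfl⟩ | rfl := exists_gap_one_eq_or_eq k c
      · simp only [insertFixed_gap, insertFixed_self, lt_iff, lt_gap_one_iff] at hab hbc hlt hnot
        have := h hbc ((gap_lt_add_iff hk).1 hc) (by omega) (by omega)
        omega
      · exact hab.asymm hbc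
  · obtain ⟨a, rfl⟩ | rfl := exists_gap_one_eq_or_eq k a
    · obtain ⟨c, rfl⟩ | rfl := exists_gap_one_eq_or_eq k c
      · simp only [insertFixed_gap, insertFixed_self, gap_lt_iff, lt_gap_one_iff]
          at hab hbc hlt hnot
        have := h (hab.trans_le hbc) ((gap_lt_add_iff hk).1 hc) (by omega) (by omega)
        omega
      · exact hbc.false
    · exact hab.false

theorem insertFixed_mem_fixedPair {p : ℕ} (hf : f ∈ fixedPair (2 * p + 1) p p) (hpk : p < k)
    (hkp : k ≤ p + 2) (hk : k ≤ 2 * p + 1) :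
    insertFixed k f ∈ fixedPair (2 * p + 2) p k := by
  obtain ⟨hf, ⟨hp, hfp, hmin⟩, -, -, hmax⟩ := mem_fixedPair.1 hf
  have hhigh (x : ℕ) (hx : p < x) (hxn : gap k 1 x < 2 * p + 2) : f x < p :=
    hmax x hx ((gap_lt_add_iff hk).1 hxn)
  refine mem_fixedPair.2 ⟨insertFixed_mem_av123 hf hk fun x y hxy hy _ hfy => ?_,
    ⟨by omega, ?_, fun x hx => ?_⟩, by omega, insertFixed_self k f, fun x hkx hx => ?_⟩
  · have hne := f.injective.ne hxy.ne
    obtain hxp | rfl | hpx := lt_trichotomy x p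
    · have := hmin x hxp
      obtain hyp | rfl | hpy := lt_trichotomy y p
      · have := hmin y hyp
        omega
      · omega
      · have := hmax y hpy hy
        omega
    · have := hmax y hxy hy
      omega
    · have := hmax x hpx (hxy.trans hy)
      have := hmax y (hpx.trans hxy) hy
      omega
  · rw [← gap_of_lt (c := 1) hpk, insertFixed_gap, hfp]
  · rw [← gap_of_lt (c := 1) (hx.trans hpk), insertFixed_gap]
    exact (hmin x hx).trans_le ((strictMono_gap k 1).le_apply)
  · obtain ⟨x, rfl⟩ | rfl := exists_gap_one_eq_or_eq k x
    · rw [insertFixed_gap, gap_lt_iff]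
      exact (hhigh x (hpk.trans_le (lt_gap_one_iff.1 hkx)) hx).trans hpk
    · exact hkx.false.elim

end InsertFixed

theorem insertFixed_skewSum_mem_fixedPair {p : ℕ} {τ ρ : Perm ℕ} (hτ : τ ∈ av123 p)
    (hρ : ρ ∈ av123 p) : insertFixed p (skewSum p p τ ρ) ∈ fixedPair (2 * p + 1) p p := by
  have hρ' := (mem_av123.1 hρ).1
  have hlow {x : ℕ} (hx : x < p) : p ≤ skewSum p p τ ρ x := by
    rw [skewSum_of_lt hρ' hx]
    exact Nat.le_add_left p _
  have hhigh {x : ℕ} (hpx : p ≤ x) (hx : x < 2 * p) : skewSum p p τ ρ x < p := by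
    obtain ⟨y, rfl⟩ := Nat.exists_eq_add_of_le hpx
    rw [skewSum_add hρ' (by omega)]
    exact apply_lt_of_mem_permsBelow hρ' (by omega)
  have hav : skewSum p p τ ρ ∈ av123 (2 * p) := two_mul p ▸ skewSum_mem_av123 hτ hρ
  have hself := insertFixed_self p (skewSum p p τ ρ)
  refine mem_fixedPair.2 ⟨insertFixed_mem_av123 hav (by omega) fun x y hxy hy hx _ => ?_,
    ⟨by omega, hself, fun x hx => ?_⟩, by omega, hself, fun x hpx hx => ?_⟩
  · obtain hxp | hpx := lt_or_ge x p
    · exact absurd (hx.1 hxp) (hlow hxp).not_gt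
    · exact absurd (hx.2 (hhigh hpx (hxy.trans hy))) hpx.not_gt
  · rw [← gap_of_lt (c := 1) hx, insertFixed_gap, lt_gap_one_iff]
    exact hlow hx
  · obtain ⟨x, rfl⟩ | rfl := exists_gap_one_eq_or_eq p x
    · rw [insertFixed_gap, gap_lt_iff]
      exact hhigh (lt_gap_one_iff.1 hpx) ((gap_lt_add_iff (by omega)).1 hx)
    · exact hpx.false.elim

theorem catalan_sq_le_card_fixedPair (p : ℕ) :
    catalan p ^ 2 ≤ #(fixedPair (2 * p + 1) p p) := by
  rw [sq, ← card_av123, ← card_product]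
  refine card_le_card_of_injOn (fun q => insertFixed p (skewSum p p q.1 q.2)) (fun q hq => ?_)
    fun q hq r hr h => ?_
  · obtain ⟨hτ, hρ⟩ := mem_product.1 hq
    exact insertFixed_skewSum_mem_fixedPair hτ hρ
  · have hq := (mem_av123.1 (mem_product.1 hq).2).1
    have hr := (mem_av123.1 (mem_product.1 hr).2).1
    obtain ⟨hρ, hτ⟩ := inflate_injective hq hr (insertFixed_injective p h)
    exact Prod.ext hτ hρ

theorem catalan_sq_le_card_fixedPair_of_lt {p k : ℕ} (hpk : p < k) (hkp : k ≤ p + 2)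
    (hk : k ≤ 2 * p + 1) : catalan p ^ 2 ≤ #(fixedPair (2 * p + 2) p k) :=
  (catalan_sq_le_card_fixedPair p).trans <|
    card_le_card_of_injOn (insertFixed k)
      (fun _ hf => insertFixed_mem_fixedPair hf hpk hkp hk) (insertFixed_injective k).injOn

theorem catalan_sq_le_card_fixedMinMax (p : ℕ) :
    catalan p ^ 2 ≤ #(fixedMinMax (2 * p + 1)) := by
  refine (catalan_sq_le_card_fixedPair p).trans ?_
  simpa only [sum_singleton] using sum_card_fixedPair_le (2 * p + 1) {(p, p)}

theorem three_mul_catalan_sq_le_card_fixedMinMax {p : ℕ} (hp : 0 < p) :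
    3 * catalan p ^ 2 ≤ #(fixedMinMax (2 * p + 2)) := by
  have hadjacent := catalan_sq_le_card_fixedPair_of_lt (p := p) (k := p + 1)
    (by omega) (by omega) (by omega)
  have hright := catalan_sq_le_card_fixedPair_of_lt (p := p) (k := p + 2)
    (by omega) (by omega) (by omega)
  have hleft := hright.trans (card_fixedPair_le_card_fixedPair_rev _ _ _)
  rw [(by omega : 2 * p + 2 - 1 - (p + 2) = p - 1), (by omega : 2 * p + 2 - 1 - p = p + 1)] at hleft
  have hsum := sum_card_fixedPair_le (2 * p + 2) {(p, p + 1), (p, p + 2), (p - 1, p + 1)}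
  rw [sum_insert, sum_insert, sum_singleton] at hsum
  · dsimp only at hsum
    omega
  · simp only [mem_singleton, Prod.mk.injEq]
    omega
  · simp only [mem_insert, mem_singleton, Prod.mk.injEq]
    omega

theorem swap_mul_swap_mem_fixedPair_five : swap 0 2 * swap 2 4 ∈ fixedPair 5 1 3 := by
  refine mem_fixedPair.2 ⟨mem_av123.2 ⟨?_, ?_⟩, ?_, ?_⟩
  · exact mul_mem_permsBelow (swap_mem_permsBelow (by decide) (by decide))
      (swap_mem_permsBelow (by decide) (by decide))
  · have (f : Perm ℕ) (hf : f = swap 0 2 * swap 2 4) :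
        ∀ c < 5, ∀ b < c, ∀ a < b, f a < f b → f c < f b := by
      subst hf
      decide
    exact fun a b c hab hbc hc => this _ rfl c hc b hbc a hab
  · exact ⟨by decide, by decide, by decide⟩
  · exact ⟨by decide, by decide, fun x hx hx' => by interval_cases x; decide⟩

theorem five_le_card_fixedMinMax : 5 ≤ #(fixedMinMax 5) := by
  have hmid : catalan 2 ^ 2 ≤ #(fixedPair 5 2 2) := catalan_sq_le_card_fixedPair 2
  rw [catalan_two] at hmid
  have hone : 0 < #(fixedPair 5 1 3) := card_pos.2 ⟨_, swap_mul_swap_mem_fixedPair_five⟩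
  have hsum := sum_card_fixedPair_le 5 {(2, 2), (1, 3)}
  rw [sum_pair (by decide)] at hsum
  dsimp only at hsum
  omega

/-! ### Comparison of the two counts -/

theorem succ_succ_mul_catalan_succ (n : ℕ) :
    (n + 2) * catalan (n + 1) = 2 * (2 * n + 1) * catalan n := by
  refine Nat.eq_of_mul_eq_mul_left n.succ_pos ?_
  calc (n + 1) * ((n + 2) * catalan (n + 1)) = (n + 1) * (n + 1).centralBinom := by
        rw [← succ_mul_catalan_eq_centralBinom (n + 1)]
    _ = 2 * (2 * n + 1) * n.centralBinom := Nat.succ_mul_centralBinom_succ n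
    _ = (n + 1) * (2 * (2 * n + 1) * catalan n) := by
        rw [← succ_mul_catalan_eq_centralBinom n]
        ring

theorem catalan_pos (n : ℕ) : 0 < catalan n :=
  Nat.pos_of_mul_pos_left (succ_mul_catalan_eq_centralBinom n ▸ n.centralBinom_pos)

theorem fourteen_mul_catalan_add_lt {n : ℕ} (hn : 11 ≤ n) :
    14 * catalan (n + 1) + catalan n < 4 * catalan (n + 2) := by
  have hsucc := succ_succ_mul_catalan_succ n
  have hsucc' := succ_succ_mul_catalan_succ (n + 1)
  refine lt_of_mul_lt_mul_left ?_ (Nat.zero_le ((n + 2) * (n + 3)))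
  calc (n + 2) * (n + 3) * (14 * catalan (n + 1) + catalan n)
      = (28 * (n + 3) * (2 * n + 1) + (n + 2) * (n + 3)) * catalan n := by
        linear_combination 14 * (n + 3) * hsucc
    _ < 16 * (2 * n + 3) * (2 * n + 1) * catalan n := by
        refine Nat.mul_lt_mul_of_pos_right ?_ (catalan_pos n)
        nlinarith
    _ = 8 * (2 * n + 3) * ((n + 2) * catalan (n + 1)) := by
        rw [hsucc]
        ring
    _ = 4 * (n + 2) * ((n + 3) * catalan (n + 2)) := by
        rw [hsucc']
        ring
    _ = (n + 2) * (n + 3) * (4 * catalan (n + 2)) := by ring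

-- Three steps of the recursion for `#(der132 n)` give
-- `8 * #(der132 (n + 3)) ≤ 4 * catalan (n + 3) - 2 * catalan (n + 2) + catalan (n + 1)`.
theorem card_der132_add_lt_catalan {n : ℕ} (hn : 10 ≤ n) :
    #(der132 (n + 3)) + 2 * catalan (n + 2) < catalan (n + 3) := by
  have hcatalan : 14 * catalan (n + 2) + catalan (n + 1) < 4 * catalan (n + 3) :=
    fourteen_mul_catalan_add_lt (by omega)
  have hrec₁ : catalan (n + 1) = 2 * #(der132 (n + 1)) + #(der132 n) :=
    catalan_succ_eq_two_mul_card_der132_add n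
  have hrec₂ : catalan (n + 2) = 2 * #(der132 (n + 2)) + #(der132 (n + 1)) :=
    catalan_succ_eq_two_mul_card_der132_add (n + 1)
  have hrec₃ : catalan (n + 3) = 2 * #(der132 (n + 3)) + #(der132 (n + 2)) :=
    catalan_succ_eq_two_mul_card_der132_add (n + 2)
  omega

theorem card_der132_add_lt_catalan_add_card_fixedMinMax {n : ℕ} (hn : 3 ≤ n) (hn' : n ≤ 11) :
    #(der132 (n + 1)) + 2 * catalan n <
      catalan (n + 1) + #(fixedMinMax (n + 1)) := by
  have hcatalan : catalan 1 = 1 ∧ catalan 2 = 2 ∧ catalan 3 = 5 ∧ catalan 4 = 14 ∧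
      catalan 5 = 42 ∧ catalan 6 = 132 ∧ catalan 7 = 429 ∧ catalan 8 = 1430 ∧ catalan 9 = 4862 ∧
      catalan 10 = 16796 ∧ catalan 11 = 58786 ∧ catalan 12 = 208012 := by
    simp [catalan_eq_centralBinom_div, Nat.centralBinom, Nat.choose]
  have hder : #(der132 1) = 0 ∧ #(der132 2) = 1 ∧ #(der132 3) = 2 ∧ #(der132 4) = 6 ∧
      #(der132 5) = 18 ∧ #(der132 6) = 57 ∧ #(der132 7) = 186 ∧ #(der132 8) = 622 ∧
      #(der132 9) = 2120 ∧ #(der132 10) = 7338 ∧ #(der132 11) = 25724 ∧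
      #(der132 12) = 91144 := by
    have hzero := card_der132_zero
    have hrec : ∀ k < 12, catalan (k + 1) = 2 * #(der132 (k + 1)) + #(der132 k) := fun k _ =>
      catalan_succ_eq_two_mul_card_der132_add k
    simp only [Nat.forall_lt_succ_right, hcatalan, Nat.not_lt_zero, IsEmpty.forall_iff,
      forall_const, true_and, Nat.reduceAdd] at hrec
    omega
  have hminMax : 3 ≤ #(fixedMinMax 4) ∧ 5 ≤ #(fixedMinMax 5) ∧
      12 ≤ #(fixedMinMax 6) ∧ 25 ≤ #(fixedMinMax 7) ∧
      75 ≤ #(fixedMinMax 8) ∧ 196 ≤ #(fixedMinMax 9) ∧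
      588 ≤ #(fixedMinMax 10) ∧ 1764 ≤ #(fixedMinMax 11) ∧
      5292 ≤ #(fixedMinMax 12) := by
    have hodd := catalan_sq_le_card_fixedMinMax
    have heven (p : ℕ) := three_mul_catalan_sq_le_card_fixedMinMax p.succ_pos
    refine ⟨?_, five_le_card_fixedMinMax, ?_, ?_, ?_, ?_, ?_, ?_, ?_⟩
    · simpa [hcatalan] using heven 0
    · simpa [hcatalan] using heven 1
    · simpa [hcatalan] using hodd 3
    · simpa [hcatalan] using heven 2
    · simpa [hcatalan] using hodd 4
    · simpa [hcatalan] using heven 3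
    · simpa [hcatalan] using hodd 5
    · simpa [hcatalan] using heven 4
  interval_cases n <;> simp only [Nat.reduceAdd] <;> omega

theorem card_der132_lt_card_der123 {n : ℕ} (hn : 4 ≤ n) : #(der132 n) < #(der123 n) := by
  obtain ⟨m, rfl⟩ := Nat.exists_eq_add_of_le' (Nat.one_le_of_lt hn)
  have hder123 := catalan_succ_add_card_fixedMinMax_le m
  obtain hm | hm := le_or_gt m 11
  · have := card_der132_add_lt_catalan_add_card_fixedMinMax (by omega) hm
    omega
  · obtain ⟨l, rfl⟩ := Nat.exists_eq_add_of_le' (show 2 ≤ m by omega)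
    have : #(der132 (l + 2 + 1)) + 2 * catalan (l + 2) < catalan (l + 2 + 1) :=
      card_der132_add_lt_catalan (by omega)
    omega

end PermPattern

theorem mainTheorem3 (n : ℕ) (hn : 4 ≤ n) :
    PermPattern.s n 0 PermPattern.p132 < PermPattern.s n 0 PermPattern.p123 := by
  rw [PermPattern.s_zero_p132, PermPattern.s_zero_p123]
  exact PermPattern.card_der132_lt_card_der123 hn
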